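/- A monounary algebra is a pair $\mathfrak A=\langle A,f\rangle$ with $A$ a nonempty set and $f:A\to A$; it is connected if for all $a,b\in A$ there are $k,l\in\mathbb N$ with $f^k(a)=f^l(b)$. Every monounary algebra is, uniquely, a disjoint union of connected ones, its connected components. Let $\mathrm{MGen}(\mathfrak A)\in\mathbb N\cup\{\infty\}$ be the minimum number of generators of $\mathfrak A$ ($\infty$ if $\mathfrak A$ is not finitely generated). A subalgebra $\mathfrak A\subseteq\mathfrak B$ is large in $\mathfrak B$ if $\mathfrak B$ is generated by $A\cup\{b\}$ for some $b\in B$. For monounary algebras $\mathfrak A,\mathfrak B$, the generator distance $\mathrm d(\mathfrak A,\mathfrak B)\in\mathbb N\cup\{\infty\}$ is the least $l$ such that there is a finite sequence of monounary algebras from $\mathfrak A$ to $\mathfrak B$ in which any two consecutive members are either isomorphic, or joined by a step of the kind "one of the two is a large subalgebra of the other", with exactly $l$ steps of the latter kind being used; it is $\infty$ if there is no such sequence. **Theorem.** Let $1\le n\le m$ be natural numbers, let $\mathfrak A$ and $\mathfrak B$ be monounary algebras with exactly $n$ and exactly $m$ connected components, respectively, and let $\mathfrak A=\bigsqcup_{i<n}\mathfrak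 A_i$ and $\mathfrak B=\bigsqcup_{j<m}\mathfrak B_j$ be their decompositions into disjoint unions of connected monounary algebras. Then $$\mathrm d(\mathfrak A,\mathfrak B)=\min_{\pi\in S_m}\Bigl(\sum_{i<n}\mathrm d\bigl(\mathfrak A_i,\mathfrak B_{\pi(i)}\bigr)+\sum_{n\le k<m}\mathrm{MGen}\bigl(\mathfrak B_{\pi(k)}\bigr)\Bigr),$$ where $S_m$ is the set of permutations of $\{0,\dots,m-1\}$ and sums are taken in $\mathbb N\cup\{\infty\}$. -/

import Mathlib

universe u

/-- A monounary algebra `⟨A, f⟩`: a nonempty set with one unary operation. -/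
structure MonounaryAlgebra : Type (u + 1) where
  carrier : Type u
  nonempty_carrier : Nonempty carrier
  op : carrier → carrier

namespace MonounaryAlgebra

/-- A set of elements is closed under the operation. -/
def IsClosedSet (A : MonounaryAlgebra.{u}) (S : Set A.carrier) : Prop :=
  ∀ x ∈ S, A.op x ∈ S

/-- The universe of the subalgebra `⟨X⟩` generated by `X`: the least closed set containing `X`. -/
def gen (A : MonounaryAlgebra.{u}) (X : Set A.carrier) : Set A.carrier :=
  ⋂₀ {S | X ⊆ S ∧ A.IsClosedSet S}

/-- A (nonempty) subset of `B` closed under the operation, regarded as an algebra. -/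
def restrict (B : MonounaryAlgebra.{u}) (S : Set B.carrier) (hne : S.Nonempty)
    (hS : B.IsClosedSet S) : MonounaryAlgebra.{u} where
  carrier := S
  nonempty_carrier := hne.to_subtype
  op x := ⟨B.op x.1, hS x.1 x.2⟩

/-- `A` is a large subalgebra of `B`: it is the subalgebra of `B` carried by a subset `S`, and
`⟨S ∪ {b}⟩ = B` for some element `b` of `B`. -/
def IsLargeSubalgebra (A B : MonounaryAlgebra.{u}) : Prop :=
  ∃ (S : Set B.carrier) (hne : S.Nonempty) (hS : B.IsClosedSet S),
    A = B.restrict S hne hS ∧ ∃ b : B.carrier, B.gen (S ∪ {b}) = Set.univ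

/-- Isomorphism of monounary algebras. -/
def Isomorphic (A B : MonounaryAlgebra.{u}) : Prop :=
  ∃ e : A.carrier ≃ B.carrier, ∀ x, e (A.op x) = B.op (e x)

/-- `HasPath A B l`: in the network of large embeddings of the class of all monounary algebras
there is a path from `A` to `B` with exactly `l` blue edges. A red edge joins two isomorphic
algebras; a blue edge joins two algebras one of which is a large subalgebra of the other. -/
inductive HasPath (A : MonounaryAlgebra.{u}) : MonounaryAlgebra.{u} → ℕ → Prop
  | nil : HasPath A A 0
  | red {B C : MonounaryAlgebra.{u}} {l : ℕ} :
      HasPath A B l → Isomorphic B C → HasPath A C l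
  | blue {B C : MonounaryAlgebra.{u}} {l : ℕ} :
      HasPath A B l → (IsLargeSubalgebra B C ∨ IsLargeSubalgebra C B) → HasPath A C (l + 1)

/-- The generator distance: the least blue-length of a path from `A` to `B`, and `⊤` if there is
no path at all. -/
noncomputable def dist (A B : MonounaryAlgebra.{u}) : ℕ∞ :=
  ⨅ (l : ℕ) (_ : HasPath A B l), (l : ℕ∞)

/-- The minimum number of generators, `⊤` if the algebra is not finitely generated. -/
noncomputable def MGen (A : MonounaryAlgebra.{u}) : ℕ∞ :=
  ⨅ (X : Set A.carrier) (_ : A.gen X = Set.univ), X.encard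

/-- Connectedness: any two elements have a common iterate. -/
def IsConnected (A : MonounaryAlgebra.{u}) : Prop :=
  ∀ a b : A.carrier, ∃ k m : ℕ, A.op^[k] a = A.op^[m] b

/-- The disjoint union of a nonempty family of monounary algebras. -/
def disjointUnion {ι : Type} [Nonempty ι] (F : ι → MonounaryAlgebra.{u}) :
    MonounaryAlgebra.{u} where
  carrier := Σ i, (F i).carrier
  nonempty_carrier :=
    let ⟨i⟩ := ‹Nonempty ι›
    let ⟨x⟩ := (F i).nonempty_carrier
    ⟨⟨i, x⟩⟩
  op x := ⟨x.1, (F x.1).op x.2⟩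

end MonounaryAlgebra

/-! Allow empty systems. A system `X` is then at distance `MGen X` from the empty one, since a step
in either direction needs at most one new generator. Padding `A` with `m - n` empty components turns
the right-hand side into a minimum over `π` of one uniform sum of distances.

Upper bound (`dist_sigma_le`): change one component at a time.

Lower bound (`Path.exists_labelling`, `exists_perm_sum_dist_le`): give the components labels that
persist along a path. A step adds or removes only iterates of one element, so it affects one label,
and the path splits into paths between equally labelled parts, of total length at most `l`.
Components with a common label at both ends are matched. The remaining ones die or are born under
distinct labels; they are paired arbitrarily, through the empty system.

Empty systems do not shorten distances between algebras (`hasPath_of_path`): a detour through the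
empty system is replaced by building `B` beside `A` and then dismantling `A` beside `B`. -/

/-- A set with one unary operation; unlike a `MonounaryAlgebra` it may be empty. -/
structure UnarySystem : Type (u + 1) where
  carrier : Type u
  op : carrier → carrier

/-! ### Extensions, paths and distance -/

namespace UnarySystem

/-- Isomorphism of unary systems. -/
def Iso (X Y : UnarySystem.{u}) : Prop :=
  ∃ e : X.carrier ≃ Y.carrier, ∀ x, e (X.op x) = Y.op (e x)

/-- `X` embeds into `Y`, and `Y` is generated by the image together with one element. -/
def Extension (X Y : UnarySystem.{u}) : Prop :=
  ∃ j : X.carrier → Y.carrier, Function.Injective j ∧ (∀ x, j (X.op x) = Y.op (j x)) ∧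
    ∃ b : Y.carrier, ∀ y, (∃ x, j x = y) ∨ ∃ k : ℕ, Y.op^[k] b = y

/-- `Path X Y l`: one can pass from `X` to `Y` by `l` extensions or inverses of extensions. -/
inductive Path (X : UnarySystem.{u}) : UnarySystem.{u} → ℕ → Prop
  | iso {Y : UnarySystem.{u}} : Iso X Y → Path X Y 0
  | up {Y Z : UnarySystem.{u}} {l : ℕ} : Path X Y l → Extension Y Z → Path X Z (l + 1)
  | down {Y Z : UnarySystem.{u}} {l : ℕ} : Path X Y l → Extension Z Y → Path X Z (l + 1)

theorem Iso.refl (X : UnarySystem.{u}) : Iso X X := ⟨Equiv.refl _, fun _ => rfl⟩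

theorem Iso.of_eq {X Y : UnarySystem.{u}} (h : X = Y) : Iso X Y := h ▸ Iso.refl X

theorem Iso.symm {X Y : UnarySystem.{u}} : Iso X Y → Iso Y X := by
  rintro ⟨e, he⟩
  exact ⟨e.symm, fun y => e.injective (by simp [he])⟩

theorem Iso.trans {X Y Z : UnarySystem.{u}} : Iso X Y → Iso Y Z → Iso X Z := by
  rintro ⟨e, he⟩ ⟨f, hf⟩
  exact ⟨e.trans f, fun x => by simp [he, hf]⟩

theorem Iso.of_isEmpty {X Y : UnarySystem.{u}} (hX : IsEmpty X.carrier)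
    (hY : IsEmpty Y.carrier) : Iso X Y :=
  ⟨Equiv.equivOfIsEmpty _ _, fun x => hX.elim x⟩

theorem iterate_map {X Y : UnarySystem.{u}} {j : X.carrier → Y.carrier}
    (hj : ∀ x, j (X.op x) = Y.op (j x)) (k : ℕ) (x : X.carrier) :
    j (X.op^[k] x) = Y.op^[k] (j x) :=
  Function.Semiconj.iterate_right (f := j) hj k x

theorem Iso.of_bijective {X Y : UnarySystem.{u}} {j : X.carrier → Y.carrier}
    (hb : Function.Bijective j) (hj : ∀ x, j (X.op x) = Y.op (j x)) : Iso X Y :=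
  ⟨Equiv.ofBijective j hb, hj⟩

theorem Extension.trans_iso {X Y Z : UnarySystem.{u}} :
    Extension X Y → Iso Y Z → Extension X Z := by
  rintro ⟨j, hj, hop, b, hb⟩ ⟨e, he⟩
  refine ⟨e ∘ j, e.injective.comp hj, fun x => by simp [hop, he], e b, fun z => ?_⟩
  rcases hb (e.symm z) with ⟨x, hx⟩ | ⟨k, hk⟩
  · exact Or.inl ⟨x, by simp [hx]⟩
  · exact Or.inr ⟨k, by rw [← iterate_map he, hk]; simp⟩

theorem Iso.trans_extension {X Y Z : UnarySystem.{u}} :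
    Iso X Y → Extension Y Z → Extension X Z := by
  rintro ⟨e, he⟩ ⟨j, hj, hop, b, hb⟩
  refine ⟨j ∘ e, hj.comp e.injective, fun x => by simp [hop, he], b, fun z => ?_⟩
  rcases hb z with ⟨y, hy⟩ | h
  · exact Or.inl ⟨e.symm y, by simp [hy]⟩
  · exact Or.inr h

/-- Isomorphisms enter a `Path` only at its start, so a final one is absorbed into the last
extension. -/
theorem Path.trans_iso {X Y Z : UnarySystem.{u}} {l : ℕ} (h : Path X Y l) (e : Iso Y Z) :
    Path X Z l := by
  cases h with
  | iso h => exact .iso (h.trans e)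
  | up h h' => exact .up h (h'.trans_iso e)
  | down h h' => exact .down h (e.symm.trans_extension h')

theorem Path.trans {X Y Z : UnarySystem.{u}} {l k : ℕ} (h : Path X Y l) (h' : Path Y Z k) :
    Path X Z (l + k) := by
  induction h' with
  | iso e => exact h.trans_iso e
  | up _ e ih => exact .up ih e
  | down _ e ih => exact .down ih e

theorem Path.symm {X Y : UnarySystem.{u}} {l : ℕ} (h : Path X Y l) : Path Y X l := by
  induction h with
  | iso e => exact .iso e.symm
  | up _ e ih =>
    have := (Path.down (.iso (.refl _)) e).trans ih
    rwa [Nat.zero_add, Nat.add_comm] at this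
  | down _ e ih =>
    have := (Path.up (.iso (.refl _)) e).trans ih
    rwa [Nat.zero_add, Nat.add_comm] at this

/-- The least length of a path, `⊤` if there is none. -/
noncomputable def dist (X Y : UnarySystem.{u}) : ℕ∞ :=
  ⨅ (l : ℕ) (_ : Path X Y l), (l : ℕ∞)

theorem Path.dist_le {X Y : UnarySystem.{u}} {l : ℕ} (h : Path X Y l) : dist X Y ≤ l :=
  iInf₂_le l h

theorem exists_path_of_dist_ne_top {X Y : UnarySystem.{u}} (h : dist X Y ≠ ⊤) :
    ∃ l : ℕ, Path X Y l ∧ (l : ℕ∞) = dist X Y := by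
  have hne : Nonempty {l : ℕ // Path X Y l} := by
    by_contra hn
    exact h (iInf₂_eq_top.2 fun l hl => (hn ⟨l, hl⟩).elim)
  obtain ⟨l, hl⟩ := ENat.exists_eq_iInf (fun l : {l : ℕ // Path X Y l} => ((l : ℕ) : ℕ∞))
  exact ⟨l.1, l.2, by rw [hl, dist, iInf_subtype]⟩

/-! ### Disjoint unions and the upper bound -/

/-- The disjoint union of a family of unary systems. -/
def sigma {ι : Type} (F : ι → UnarySystem.{u}) : UnarySystem.{u} where
  carrier := Σ i, (F i).carrier
  op x := ⟨x.1, (F x.1).op x.2⟩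

theorem sigma_iso {ι : Type} {F G : ι → UnarySystem.{u}} (h : ∀ i, Iso (F i) (G i)) :
    Iso (sigma F) (sigma G) := by
  choose e he using h
  exact ⟨Equiv.sigmaCongrRight e, fun ⟨i, x⟩ => congrArg (Sigma.mk i) (he i x)⟩

theorem iterate_sigma {ι : Type} (F : ι → UnarySystem.{u}) (i : ι) (x : (F i).carrier) (k : ℕ) :
    (sigma F).op^[k] ⟨i, x⟩ = ⟨i, (F i).op^[k] x⟩ :=
  (iterate_map (Y := sigma F) (j := fun x : (F i).carrier => ⟨i, x⟩) (fun _ => rfl) k x).symm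

theorem sigma_extension {ι : Type} {F G : ι → UnarySystem.{u}} (i : ι)
    (hi : Extension (F i) (G i)) (h : ∀ k, k ≠ i → Iso (F k) (G k)) :
    Extension (sigma F) (sigma G) := by
  classical
  -- Stated for all `k` at once, so that one choice yields a family of maps to glue.
  have key : ∀ k, ∃ j : (F k).carrier → (G k).carrier, Function.Injective j ∧
      (∀ x, j ((F k).op x) = (G k).op (j x)) ∧ (k ≠ i → Function.Surjective j) ∧
      (k = i → ∃ b, ∀ y, (∃ x, j x = y) ∨ ∃ k' : ℕ, (G k).op^[k'] b = y) := by
    intro k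
    by_cases hk : k = i
    · subst hk
      obtain ⟨j, h1, h2, h3⟩ := hi
      exact ⟨j, h1, h2, fun h => (h rfl).elim, fun _ => h3⟩
    · obtain ⟨e, he⟩ := h k hk
      exact ⟨e, e.injective, he, fun _ => e.surjective, fun h => (hk h).elim⟩
  choose j hinj hop hsurj hgen using key
  obtain ⟨b, hb⟩ := hgen i rfl
  refine ⟨Sigma.map id j, Function.injective_id.sigma_map hinj, fun x => ?_, ⟨i, b⟩, ?_⟩
  · simp [sigma, Sigma.map, hop]
  · rintro ⟨k, y⟩
    by_cases hk : k = i
    · subst hk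
      rcases hb y with ⟨x, rfl⟩ | ⟨t, rfl⟩
      · exact Or.inl ⟨⟨k, x⟩, rfl⟩
      · exact Or.inr ⟨t, iterate_sigma G k b t⟩
    · obtain ⟨x, rfl⟩ := hsurj k hk y
      exact Or.inl ⟨⟨k, x⟩, rfl⟩

theorem Path.sigma_of_eq_off {ι : Type} [DecidableEq ι] {i : ι} {X Y : UnarySystem.{u}} {l : ℕ}
    (h : Path X Y l) {F G : ι → UnarySystem.{u}} (hF : F i = X) (hG : G i = Y)
    (hFG : ∀ k, k ≠ i → F k = G k) : Path (sigma F) (sigma G) l := by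
  induction h generalizing G with
  | iso e =>
    refine .iso (sigma_iso fun k => ?_)
    by_cases hk : k = i
    · subst hk; rwa [hF, hG]
    · exact .of_eq (hFG k hk)
  | @up Y Z l _ e ih =>
    refine .up (ih (G := Function.update G i Y) (by simp)
      fun k hk => by simp [hk, hFG k hk]) (sigma_extension i (by simpa [hG] using e) fun k hk => ?_)
    exact .of_eq (by simp [hk])
  | @down Y Z l _ e ih =>
    refine .down (ih (G := Function.update G i Y) (by simp)
      fun k hk => by simp [hk, hFG k hk]) (sigma_extension i (by simpa [hG] using e) fun k hk => ?_)
    exact .of_eq (by simp [hk])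

/-- `s.piecewise G F` interpolates: the components in `s` have already been changed. -/
theorem Path.sigma {ι : Type} [Fintype ι] {F G : ι → UnarySystem.{u}} {c : ι → ℕ}
    (h : ∀ i, Path (F i) (G i) (c i)) : Path (sigma F) (sigma G) (∑ i, c i) := by
  classical
  have key : ∀ s : Finset ι, Path (UnarySystem.sigma F) (UnarySystem.sigma (s.piecewise G F))
      (∑ i ∈ s, c i) := by
    intro s
    induction s using Finset.induction_on with
    | empty => simpa using Path.iso (Iso.refl _)
    | insert a s ha ih =>
      rw [Finset.sum_insert ha, Nat.add_comm, Finset.piecewise_insert]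
      refine ih.trans ((h a).sigma_of_eq_off (i := a) ?_ ?_ ?_)
      · simp [ha]
      · simp
      · intro k hk; simp [hk]
  simpa using key Finset.univ

theorem dist_sigma_le {ι : Type} [Fintype ι] (F G : ι → UnarySystem.{u}) :
    dist (sigma F) (sigma G) ≤ ∑ i, dist (F i) (G i) := by
  by_cases h : ∀ i, dist (F i) (G i) ≠ ⊤
  · choose c hc hc' using fun i => exists_path_of_dist_ne_top (h i)
    simpa [← hc'] using (Path.sigma hc).dist_le
  · push Not at h
    obtain ⟨i, hi⟩ := h
    have : ∑ i, dist (F i) (G i) = ⊤ :=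
      top_le_iff.1 (hi ▸ Finset.single_le_sum (f := fun i => dist (F i) (G i))
        (fun _ _ => zero_le) (Finset.mem_univ i))
    simp [this]

/-! ### Labelled components and the lower bound -/

/-- Two elements have a common iterate. -/
def Meet (X : UnarySystem.{u}) (x y : X.carrier) : Prop := ∃ k l : ℕ, X.op^[k] x = X.op^[l] y

theorem Meet.symm {X : UnarySystem.{u}} {x y : X.carrier} : X.Meet x y → X.Meet y x :=
  fun ⟨k, l, h⟩ => ⟨l, k, h.symm⟩

theorem Meet.trans {X : UnarySystem.{u}} {x y z : X.carrier} :
    X.Meet x y → X.Meet y z → X.Meet x z := by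
  rintro ⟨a, b, h⟩ ⟨c, d, h'⟩
  refine ⟨c + a, b + d, ?_⟩
  rw [Function.iterate_add_apply, h, ← Function.iterate_add_apply, Nat.add_comm c,
    Function.iterate_add_apply, h', ← Function.iterate_add_apply]

theorem Meet.iterate {X : UnarySystem.{u}} (x : X.carrier) (k l : ℕ) :
    X.Meet (X.op^[k] x) (X.op^[l] x) :=
  ⟨l, k, by rw [← Function.iterate_add_apply, ← Function.iterate_add_apply, Nat.add_comm]⟩

theorem Meet.map {X Y : UnarySystem.{u}} {j : X.carrier → Y.carrier}
    (hj : ∀ x, j (X.op x) = Y.op (j x)) {x y : X.carrier} (h : X.Meet x y) :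
    Y.Meet (j x) (j y) := by
  obtain ⟨k, l, h⟩ := h
  exact ⟨k, l, by rw [← iterate_map hj, h, iterate_map hj]⟩

theorem Meet.of_map {X Y : UnarySystem.{u}} {j : X.carrier → Y.carrier}
    (hj : ∀ x, j (X.op x) = Y.op (j x)) (hinj : Function.Injective j) {x y : X.carrier}
    (h : Y.Meet (j x) (j y)) : X.Meet x y := by
  obtain ⟨k, l, h⟩ := h
  exact ⟨k, l, hinj (by rw [iterate_map hj, h, iterate_map hj])⟩

/-- A labelling of the connected components by natural numbers, only finitely many being used. -/
structure IsLabelling (X : UnarySystem.{u}) (p : X.carrier → ℕ) : Prop where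
  map_op : ∀ x, p (X.op x) = p x
  meet : ∀ x y, p x = p y → X.Meet x y
  finite_range : (Set.range p).Finite

theorem IsLabelling.map_iterate {X : UnarySystem.{u}} {p : X.carrier → ℕ} (hp : X.IsLabelling p)
    (k : ℕ) (x : X.carrier) : p (X.op^[k] x) = p x := by
  induction k with
  | zero => rfl
  | succ k ih => rw [Function.iterate_succ_apply', hp.map_op, ih]

theorem IsLabelling.eq_of_meet {X : UnarySystem.{u}} {p : X.carrier → ℕ} (hp : X.IsLabelling p)
    {x y : X.carrier} : X.Meet x y → p x = p y := by
  rintro ⟨k, l, h⟩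
  rw [← hp.map_iterate k x, h, hp.map_iterate]

theorem IsLabelling.comp {X Y : UnarySystem.{u}} {j : X.carrier → Y.carrier}
    (hj : ∀ x, j (X.op x) = Y.op (j x)) (hinj : Function.Injective j) {p : Y.carrier → ℕ}
    (hp : Y.IsLabelling p) : X.IsLabelling (p ∘ j) where
  map_op x := by simp [hj, hp.map_op]
  meet x y h := .of_map hj hinj (hp.meet _ _ h)
  finite_range := hp.finite_range.subset (Set.range_comp_subset_range j p)

/-- The elements with label `i`. -/
def fiber (X : UnarySystem.{u}) {p : X.carrier → ℕ} (hp : X.IsLabelling p) (i : ℕ) :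
    UnarySystem.{u} where
  carrier := {x // p x = i}
  op x := ⟨X.op x.1, (hp.map_op _).trans x.2⟩

theorem fiber_iso_of_surjOn {X Y : UnarySystem.{u}} {j : X.carrier → Y.carrier}
    (hj : ∀ x, j (X.op x) = Y.op (j x)) (hinj : Function.Injective j) {p : X.carrier → ℕ}
    {q : Y.carrier → ℕ} (hp : X.IsLabelling p) (hq : Y.IsLabelling q) (hpq : ∀ x, q (j x) = p x)
    {i : ℕ} (hs : ∀ y, q y = i → ∃ x, j x = y) : Iso (X.fiber hp i) (Y.fiber hq i) := by
  refine .of_bijective (X := X.fiber hp i) (Y := Y.fiber hq i)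
    (j := fun x => ⟨j x.1, (hpq _).trans x.2⟩) ⟨?_, ?_⟩ fun x => Subtype.ext (hj x.1)
  · intro x y h
    exact Subtype.ext (hinj (congrArg Subtype.val h))
  · rintro ⟨y, hy⟩
    obtain ⟨x, rfl⟩ := hs y hy
    exact ⟨⟨x, (hpq x).symm.trans hy⟩, rfl⟩

theorem fiber_extension {X Y : UnarySystem.{u}} {j : X.carrier → Y.carrier}
    (hj : ∀ x, j (X.op x) = Y.op (j x)) (hinj : Function.Injective j) {p : X.carrier → ℕ}
    {q : Y.carrier → ℕ} (hp : X.IsLabelling p) (hq : Y.IsLabelling q) (hpq : ∀ x, q (j x) = p x)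
    {b : Y.carrier} (hb : ∀ y, (∃ x, j x = y) ∨ ∃ k : ℕ, Y.op^[k] b = y) :
    Extension (X.fiber hp (q b)) (Y.fiber hq (q b)) := by
  refine ⟨fun x => ⟨j x.1, (hpq _).trans x.2⟩, ?_, fun x => Subtype.ext (hj x.1), ⟨b, rfl⟩, ?_⟩
  · intro x y h
    exact Subtype.ext (hinj (congrArg Subtype.val h))
  · rintro ⟨y, hy⟩
    rcases hb y with ⟨x, rfl⟩ | ⟨k, rfl⟩
    · exact Or.inl ⟨⟨x, (hpq x).symm.trans hy⟩, rfl⟩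
    · exact Or.inr ⟨k, Subtype.ext
        (iterate_map (X := Y.fiber hq (q b)) (Y := Y) (j := Subtype.val) (fun _ => rfl) k ⟨b, rfl⟩)⟩

/-- All new elements are iterates of `b`, hence carry the label of `b`; every other fiber is
unchanged. -/
theorem fiber_iso_of_ne {X Y : UnarySystem.{u}} {j : X.carrier → Y.carrier}
    (hj : ∀ x, j (X.op x) = Y.op (j x)) (hinj : Function.Injective j) {p : X.carrier → ℕ}
    {q : Y.carrier → ℕ} (hp : X.IsLabelling p) (hq : Y.IsLabelling q) (hpq : ∀ x, q (j x) = p x)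
    {b : Y.carrier} (hb : ∀ y, (∃ x, j x = y) ∨ ∃ k : ℕ, Y.op^[k] b = y) {i : ℕ} (hi : i ≠ q b) :
    Iso (X.fiber hp i) (Y.fiber hq i) := by
  refine fiber_iso_of_surjOn hj hinj hp hq hpq fun y hy => (hb y).resolve_right ?_
  rintro ⟨k, rfl⟩
  exact hi (hy.symm.trans (hq.map_iterate k b))

/-- If the orbit of `b` meets the old part, its label is forced; otherwise `b` starts a new
component, and finiteness of the range supplies a fresh label. -/
theorem IsLabelling.exists_extension {X Y : UnarySystem.{u}} {j : X.carrier → Y.carrier}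
    (hj : ∀ x, j (X.op x) = Y.op (j x)) (hinj : Function.Injective j) {p : X.carrier → ℕ}
    (hp : X.IsLabelling p) {b : Y.carrier}
    (hb : ∀ y, (∃ x, j x = y) ∨ ∃ k : ℕ, Y.op^[k] b = y) :
    ∃ q : Y.carrier → ℕ, Y.IsLabelling q ∧ ∀ x, q (j x) = p x := by
  classical
  have hi₀ : ∃ i₀ : ℕ, ∀ x, p x = i₀ ↔ Y.Meet (j x) b := by
    by_cases h : ∃ x₀, Y.Meet (j x₀) b
    · obtain ⟨x₀, h₀⟩ := h
      refine ⟨p x₀, fun x => ⟨fun hx => ((hp.meet _ _ hx).map hj).trans h₀, fun hx => ?_⟩⟩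
      exact hp.eq_of_meet (.of_map hj hinj (hx.trans h₀.symm))
    · obtain ⟨i₀, h₀⟩ := hp.finite_range.exists_notMem
      exact ⟨i₀, fun x => ⟨fun hx => (h₀ ⟨x, hx⟩).elim, fun hx => (h ⟨x, hx⟩).elim⟩⟩
  obtain ⟨i₀, h₀⟩ := hi₀
  let q : Y.carrier → ℕ := fun y => if h : ∃ x, j x = y then p h.choose else i₀
  have hqj : ∀ x, q (j x) = p x := by
    intro x
    have h : ∃ x', j x' = j x := ⟨x, rfl⟩
    simp only [q, dif_pos h]
    exact congrArg p (hinj h.choose_spec)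
  have hq₀ : ∀ y, Y.Meet y b → q y = i₀ := by
    intro y hy
    by_cases h : ∃ x, j x = y
    · obtain ⟨x, rfl⟩ := h
      rw [hqj, h₀]; exact hy
    · simp only [q, dif_neg h]
  have hmeet : ∀ k : ℕ, Y.Meet (Y.op^[k] b) b := fun k => Meet.iterate b k 0
  refine ⟨q, ⟨fun y => ?_, fun y z hyz => ?_, ?_⟩, hqj⟩
  · rcases hb y with ⟨x, rfl⟩ | ⟨k, rfl⟩
    · rw [← hj, hqj, hqj, hp.map_op]
    · rw [hq₀ _ (hmeet k), ← Function.iterate_succ_apply' Y.op k b, hq₀ _ (hmeet _)]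
  · rcases hb y with ⟨x, rfl⟩ | ⟨k, rfl⟩ <;> rcases hb z with ⟨x', rfl⟩ | ⟨k', rfl⟩
    · rw [hqj, hqj] at hyz
      exact (hp.meet _ _ hyz).map hj
    · rw [hqj, hq₀ _ (hmeet k'), h₀] at hyz
      exact hyz.trans (hmeet k').symm
    · rw [hqj, hq₀ _ (hmeet k), eq_comm, h₀] at hyz
      exact (hmeet k).trans hyz.symm
    · exact Meet.iterate b k k'
  · refine (hp.finite_range.insert i₀).subset ?_
    rintro _ ⟨y, rfl⟩
    rcases hb y with ⟨x, rfl⟩ | ⟨k, rfl⟩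
    · exact Or.inr ⟨x, (hqj x).symm⟩
    · exact Or.inl (hq₀ _ (hmeet k))

/-- A path transports a labelling, and splits into paths between the fibers. -/
theorem Path.exists_labelling {X Y : UnarySystem.{u}} {l : ℕ} (h : Path X Y l)
    {p : X.carrier → ℕ} (hp : X.IsLabelling p) :
    ∃ (q : Y.carrier → ℕ) (hq : Y.IsLabelling q) (c : ℕ → ℕ),
      (∀ i, Path (X.fiber hp i) (Y.fiber hq i) (c i)) ∧ ∀ s : Finset ℕ, ∑ i ∈ s, c i ≤ l := by
  -- Each step is charged to the single label `i₀` of its generator. Labels are infinite in number,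
  -- so the total is bounded on finite sets.
  have hsum : ∀ (c : ℕ → ℕ) (l i₀ : ℕ), (∀ s : Finset ℕ, ∑ i ∈ s, c i ≤ l) →
      ∀ s : Finset ℕ, ∑ i ∈ s, (c i + if i = i₀ then 1 else 0) ≤ l + 1 := by
    intro c l i₀ h s
    rw [Finset.sum_add_distrib, Finset.sum_ite_eq']
    have := h s
    split_ifs <;> omega
  induction h with
  | @iso Y e =>
    obtain ⟨e, he⟩ := e
    have he' : ∀ y, e.symm (Y.op y) = X.op (e.symm y) := fun y => e.injective (by simp [he])
    refine ⟨p ∘ e.symm, hp.comp he' e.symm.injective, fun _ => 0, fun i => .iso ?_, by simp⟩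
    exact fiber_iso_of_surjOn he e.injective _ _ (by simp) fun y _ => ⟨e.symm y, by simp⟩
  | @up Y Z l _ e ih =>
    obtain ⟨q, hq, c, hc, hs⟩ := ih
    obtain ⟨j, hinj, hj, b, hb⟩ := e
    obtain ⟨r, hr, hrq⟩ := hq.exists_extension hj hinj hb
    refine ⟨r, hr, fun i => c i + if i = r b then 1 else 0, fun i => ?_, hsum c l _ hs⟩
    dsimp only
    split_ifs with hi
    · subst hi
      exact (hc _).up (fiber_extension hj hinj hq hr hrq hb)
    · exact (hc _).trans_iso (fiber_iso_of_ne hj hinj hq hr hrq hb hi)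
  | @down Y Z l _ e ih =>
    obtain ⟨q, hq, c, hc, hs⟩ := ih
    obtain ⟨j, hinj, hj, b, hb⟩ := e
    have hr := hq.comp hj hinj
    refine ⟨_, hr, fun i => c i + if i = q b then 1 else 0, fun i => ?_, hsum c l _ hs⟩
    dsimp only
    split_ifs with hi
    · subst hi
      exact (hc _).down (fiber_extension hj hinj hr hq (fun _ => rfl) hb)
    · exact (hc _).trans_iso (fiber_iso_of_ne hj hinj hr hq (fun _ => rfl) hb hi).symm

/-- A path between two disjoint unions of `m` systems, each empty or connected and the latter ones
nonempty, is at least as long as some matching of the components. -/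
theorem exists_perm_sum_dist_le {m l : ℕ} {F G : Fin m → UnarySystem.{u}}
    (hF : ∀ i x y, (F i).Meet x y) (hG : ∀ i x y, (G i).Meet x y)
    (hne : ∀ i, Nonempty (G i).carrier) (h : Path (sigma F) (sigma G) l) :
    ∃ π : Equiv.Perm (Fin m), ∑ i, dist (F i) (G (π i)) ≤ l := by
  classical
  let p : (sigma F).carrier → ℕ := fun x => x.1
  have hp : (sigma F).IsLabelling p := by
    refine ⟨fun x => rfl, ?_, (Set.finite_lt_nat m).subset ?_⟩
    · rintro ⟨i, x⟩ ⟨i', y⟩ h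
      obtain rfl : i = i' := Fin.ext h
      exact (hF i x y).map (Y := sigma F) (j := fun x => ⟨i, x⟩) fun _ => rfl
    · rintro _ ⟨x, rfl⟩
      exact x.1.2
  obtain ⟨q, hq, c, hc, hs⟩ := h.exists_labelling hp
  have hF_iso : ∀ i : Fin m, Iso (F i) ((sigma F).fiber hp i) := by
    intro i
    refine .of_bijective (Y := (sigma F).fiber hp i) (j := fun x => ⟨⟨i, x⟩, rfl⟩) ⟨?_, ?_⟩
      fun _ => rfl
    · intro x y h
      exact sigma_mk_injective (β := fun i => (F i).carrier) (congrArg Subtype.val h)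
    · rintro ⟨⟨i', x⟩, h⟩
      obtain rfl : i' = i := Fin.ext h
      exact ⟨x, rfl⟩
  -- Labels from `m` on are unused at the start: their components are born along the path.
  have hF_empty : ∀ k, m ≤ k → IsEmpty ((sigma F).fiber hp k).carrier := fun k hk =>
    ⟨fun x => absurd x.1.1.2 (by have : (x.1.1 : ℕ) = k := x.2; omega)⟩
  let y₀ := fun j => (hne j).some
  -- The label that the component `G j` has at the end of the path.
  let τ : Fin m → ℕ := fun j => q ⟨j, y₀ j⟩
  have hτ : ∀ j y, q ⟨j, y⟩ = τ j := fun j y => hq.eq_of_meet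
    ((hG j y (y₀ j)).map (Y := sigma G) (j := fun x => ⟨j, x⟩) fun _ => rfl)
  have hτ_inj : Function.Injective τ := by
    intro j j' h
    obtain ⟨k, k', h⟩ := hq.meet _ _ h
    rw [iterate_sigma, iterate_sigma] at h
    exact congrArg Sigma.fst h
  have hG_iso : ∀ j : Fin m, Iso ((sigma G).fiber hq (τ j)) (G j) := by
    intro j
    refine .symm (.of_bijective (Y := (sigma G).fiber hq (τ j))
      (j := fun y => ⟨⟨j, y⟩, hτ j y⟩) ⟨?_, ?_⟩ fun _ => rfl)
    · intro x y h
      exact sigma_mk_injective (β := fun i => (G i).carrier) (congrArg Subtype.val h)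
    · rintro ⟨⟨j', y⟩, h⟩
      obtain rfl : j' = j := hτ_inj ((hτ j' y).symm.trans h)
      exact ⟨y, rfl⟩
  have hG_empty : ∀ k, k ∉ Set.range τ → IsEmpty ((sigma G).fiber hq k).carrier := fun k hk =>
    ⟨fun ⟨⟨j, y⟩, h⟩ => hk ⟨j, (hτ j y).symm.trans h⟩⟩
  -- The components surviving from start to end, matched by label; `π` extends this matching
  -- arbitrarily to a permutation.
  let e : {i : Fin m // (i : ℕ) ∈ Set.range τ} ≃ {j : Fin m // τ j < m} :=
    Equiv.symm <| Equiv.ofBijective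
      (fun j : {j : Fin m // τ j < m} =>
        (⟨⟨τ j, j.2⟩, j.1, rfl⟩ : {i : Fin m // (i : ℕ) ∈ Set.range τ})) <| by
      refine ⟨fun j j' h => ?_, ?_⟩
      · exact Subtype.ext (hτ_inj (congrArg
          (fun i : {i : Fin m // (i : ℕ) ∈ Set.range τ} => ((i.1 : Fin m) : ℕ)) h))
      · rintro ⟨i, j, hj⟩
        exact ⟨⟨j, hj ▸ i.2⟩, Subtype.ext (Fin.ext hj)⟩
  have he : ∀ i, τ (e i) = i.1 := fun i =>
    congrArg (fun i : {i : Fin m // (i : ℕ) ∈ Set.range τ} => ((i.1 : Fin m) : ℕ))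
      (e.symm_apply_apply i)
  let π := e.extendSubtype
  have hπ_mem : ∀ i : Fin m, (i : ℕ) ∈ Set.range τ → τ (π i) = i := fun i hi => by
    rw [Equiv.extendSubtype_apply_of_mem e i hi]
    exact he ⟨i, hi⟩
  have hπ_notMem : ∀ i : Fin m, (i : ℕ) ∉ Set.range τ → m ≤ τ (π i) := fun i hi =>
    not_lt.1 (Equiv.extendSubtype_not_mem e i hi)
  -- If label `i` does not survive, `F i` shrinks to the empty system at cost `c i`, and `G (π i)`
  -- grows from it at the cost of its own label.
  have hdist : ∀ i : Fin m, dist (F i) (G (π i)) ≤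
      ((c i + if (i : ℕ) ∈ Set.range τ then 0 else c (τ (π i)) : ℕ) : ℕ∞) := by
    intro i
    have h1 : Path (F i) ((sigma G).fiber hq i) (c i) := by
      simpa using (Path.iso (hF_iso i)).trans (hc i)
    have h2 := (hc (τ (π i))).trans_iso (hG_iso (π i))
    split_ifs with hi
    · refine Path.dist_le (h1.trans_iso ?_)
      have := hG_iso (π i)
      rwa [hπ_mem i hi] at this
    · exact Path.dist_le ((h1.trans_iso (.of_isEmpty (hG_empty _ hi)
        (hF_empty _ (hπ_notMem i hi)))).trans h2)
  refine ⟨π, (Finset.sum_le_sum fun i _ => hdist i).trans ?_⟩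
  rw [← Nat.cast_sum]
  refine Nat.cast_le.2 ?_
  rw [Finset.sum_add_distrib, Finset.sum_ite, Finset.sum_const_zero, zero_add]
  -- Start labels are below `m` and labels of born components are not, so no cost is counted twice.
  have hdisj : Disjoint (Finset.univ.map (Fin.valEmbedding (n := m)))
      ((Finset.univ.filter fun i : Fin m => (i : ℕ) ∉ Set.range τ).map
        (π.toEmbedding.trans ⟨τ, hτ_inj⟩)) := by
    rw [Finset.disjoint_left]
    intro k hk hk'
    simp only [Finset.mem_map, Finset.mem_filter, Finset.mem_univ, true_and] at hk hk'
    obtain ⟨i, rfl⟩ := hk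
    obtain ⟨i', hi', h⟩ := hk'
    have h' : τ (π i') = i := h
    have := hπ_notMem i' hi'
    omega
  have := hs (Finset.disjUnion _ _ hdisj)
  rw [Finset.sum_disjUnion, Finset.sum_map, Finset.sum_map] at this
  exact this

end UnarySystem

/-! ### Generators and the distance from the empty system -/

namespace UnarySystem

/-- Every element is an iterate of an element of `s`. -/
def Generates (X : UnarySystem.{u}) (s : Set X.carrier) : Prop :=
  ∀ y, ∃ x ∈ s, ∃ k : ℕ, X.op^[k] x = y

theorem Iso.exists_generates {X Y : UnarySystem.{u}} (h : Iso X Y) {s : Set X.carrier}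
    (hs : X.Generates s) : ∃ t, Y.Generates t ∧ t.encard ≤ s.encard := by
  obtain ⟨e, he⟩ := h
  refine ⟨e '' s, fun y => ?_, Set.encard_image_le e s⟩
  obtain ⟨x, hx, k, hk⟩ := hs (e.symm y)
  exact ⟨e x, ⟨x, hx, rfl⟩, k, by rw [← iterate_map he, hk, e.apply_symm_apply]⟩

theorem Extension.exists_generates {X Y : UnarySystem.{u}} (h : Extension X Y) {s : Set X.carrier}
    (hs : X.Generates s) : ∃ t, Y.Generates t ∧ t.encard ≤ s.encard + 1 := by
  obtain ⟨j, -, hj, b, hb⟩ := h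
  refine ⟨insert b (j '' s), fun y => ?_, (Set.encard_insert_le _ _).trans
    (add_le_add_left (Set.encard_image_le j s) 1)⟩
  rcases hb y with ⟨x, rfl⟩ | ⟨k, hk⟩
  · obtain ⟨x', hx', k, rfl⟩ := hs x
    exact ⟨j x', Or.inr ⟨x', hx', rfl⟩, k, (iterate_map hj k x').symm⟩
  · exact ⟨b, Or.inl rfl, k, hk⟩

/-- Generators of `Y` outside `X` are iterates of `b`, so they reach `X` only through the first
iterate of `b` lying in `X`. That one element replaces them all; if there is none, they contribute
nothing to `X`. -/
theorem Extension.exists_generates_left {X Y : UnarySystem.{u}} (h : Extension X Y)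
    {s : Set Y.carrier} (hs : Y.Generates s) :
    ∃ t, X.Generates t ∧ t.encard ≤ s.encard + 1 := by
  classical
  obtain ⟨j, hinj, hj, b, hb⟩ := h
  have hcard : (j ⁻¹' s).encard ≤ s.encard := by
    rw [← hinj.encard_image]
    exact Set.encard_le_encard (Set.image_preimage_subset j s)
  by_cases hent : ∃ (k : ℕ) (x : X.carrier), j x = Y.op^[k] b
  · obtain ⟨e, he⟩ := Nat.find_spec hent
    refine ⟨insert e (j ⁻¹' s), fun y => ?_, (Set.encard_insert_le _ _).trans
      (add_le_add_left hcard 1)⟩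
    obtain ⟨x, hx, k, hk⟩ := hs (j y)
    rcases hb x with ⟨x', rfl⟩ | ⟨t, rfl⟩
    · exact ⟨x', Or.inr hx, k, hinj (by rw [iterate_map hj, hk])⟩
    · rw [← Function.iterate_add_apply] at hk
      have hle : Nat.find hent ≤ k + t := Nat.find_min' hent ⟨y, hk.symm⟩
      refine ⟨e, Or.inl rfl, k + t - Nat.find hent, hinj ?_⟩
      rw [iterate_map hj, he, ← Function.iterate_add_apply, Nat.sub_add_cancel hle, hk]
  · refine ⟨j ⁻¹' s, fun y => ?_, hcard.trans le_self_add⟩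
    obtain ⟨x, hx, k, hk⟩ := hs (j y)
    rcases hb x with ⟨x', rfl⟩ | ⟨t, rfl⟩
    · exact ⟨x', hx, k, hinj (by rw [iterate_map hj, hk])⟩
    · exact (hent ⟨k + t, y, by rw [Function.iterate_add_apply, hk]⟩).elim

theorem Path.exists_generates {X Y : UnarySystem.{u}} {l : ℕ} (h : Path X Y l)
    (hX : IsEmpty X.carrier) : ∃ t, Y.Generates t ∧ t.encard ≤ l := by
  induction h with
  | iso e => simpa using e.exists_generates (s := ∅) fun x => hX.elim x
  | up _ e ih =>
    obtain ⟨s, hs, hc⟩ := ih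
    obtain ⟨t, ht, hc'⟩ := e.exists_generates hs
    exact ⟨t, ht, hc'.trans (by push_cast; gcongr)⟩
  | down _ e ih =>
    obtain ⟨s, hs, hc⟩ := ih
    obtain ⟨t, ht, hc'⟩ := e.exists_generates_left hs
    exact ⟨t, ht, hc'.trans (by push_cast; gcongr)⟩

/-- The subsystem generated by a set. -/
def span (X : UnarySystem.{u}) (s : Set X.carrier) : UnarySystem.{u} where
  carrier := {y // ∃ x ∈ s, ∃ k : ℕ, X.op^[k] x = y}
  op y := ⟨X.op y.1, by
    obtain ⟨x, hx, k, hk⟩ := y.2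
    exact ⟨x, hx, k + 1, by rw [Function.iterate_succ_apply', hk]⟩⟩

theorem span_extension (X : UnarySystem.{u}) (s : Set X.carrier) (a : X.carrier) :
    Extension (X.span s) (X.span (insert a s)) := by
  refine ⟨fun y => ⟨y.1, ?_⟩, ?_, fun _ => rfl, ⟨a, a, Or.inl rfl, 0, rfl⟩, ?_⟩
  · obtain ⟨x, hx, h⟩ := y.2
    exact ⟨x, Or.inr hx, h⟩
  · intro x y h
    exact Subtype.ext (congrArg (fun z : (X.span (insert a s)).carrier => z.1) h)
  · rintro ⟨y, x, rfl | hx, k, rfl⟩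
    · exact Or.inr ⟨k, Subtype.ext
        (iterate_map (X := X.span (insert x s)) (Y := X) (j := Subtype.val) (fun _ => rfl) k _)⟩
    · exact Or.inl ⟨⟨_, x, hx, k, rfl⟩, rfl⟩

theorem Generates.path {E X : UnarySystem.{u}} (hE : IsEmpty E.carrier) {s : Finset X.carrier}
    (hs : X.Generates s) : Path E X s.card := by
  classical
  have key : ∀ t : Finset X.carrier, Path E (X.span t) t.card := by
    intro t
    induction t using Finset.induction_on with
    | empty => exact .iso (.of_isEmpty hE ⟨fun ⟨_, _, h, _⟩ => by simp at h⟩)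
    | insert a t ha ih =>
      rw [Finset.card_insert_of_notMem ha, Finset.coe_insert]
      exact ih.up (X.span_extension t a)
  refine (key s).trans_iso (.of_bijective (X := X.span s) (j := Subtype.val)
    ⟨Subtype.val_injective, fun y => ⟨⟨y, hs y⟩, rfl⟩⟩ fun _ => rfl)

end UnarySystem

/-! ### Comparison of monounary algebras with unary systems -/

namespace MonounaryAlgebra

open UnarySystem (Path Extension Iso)

/-- A monounary algebra, as a unary system. -/
def toUnarySystem (A : MonounaryAlgebra.{u}) : UnarySystem.{u} := ⟨A.carrier, A.op⟩

theorem mem_gen_iff {A : MonounaryAlgebra.{u}} {X : Set A.carrier} {y : A.carrier} :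
    y ∈ A.gen X ↔ ∃ x ∈ X, ∃ k : ℕ, A.op^[k] x = y := by
  constructor
  · refine fun h => h {y | ∃ x ∈ X, ∃ k : ℕ, A.op^[k] x = y} ⟨fun x hx => ⟨x, hx, 0, rfl⟩, ?_⟩
    rintro y ⟨x, hx, k, rfl⟩
    exact ⟨x, hx, k + 1, Function.iterate_succ_apply' _ _ _⟩
  · rintro ⟨x, hx, k, rfl⟩ S ⟨hXS, hS⟩
    induction k with
    | zero => exact hXS hx
    | succ k ih => rw [Function.iterate_succ_apply']; exact hS _ ih

theorem gen_eq_univ_iff {A : MonounaryAlgebra.{u}} {X : Set A.carrier} :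
    A.gen X = Set.univ ↔ A.toUnarySystem.Generates X := by
  simp only [Set.eq_univ_iff_forall, mem_gen_iff]
  rfl

theorem IsLargeSubalgebra.extension {A B : MonounaryAlgebra.{u}} (h : IsLargeSubalgebra A B) :
    Extension A.toUnarySystem B.toUnarySystem := by
  obtain ⟨S, hne, hS, rfl, b, hb⟩ := h
  refine ⟨Subtype.val, Subtype.val_injective, fun _ => rfl, b, fun y => ?_⟩
  obtain ⟨x, hx | rfl, k, rfl⟩ := gen_eq_univ_iff.1 hb y
  · refine Or.inl ⟨⟨_, ?_⟩, rfl⟩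
    induction k with
    | zero => exact hx
    | succ k ih => rw [Function.iterate_succ_apply']; exact hS _ ih
  · exact Or.inr ⟨k, rfl⟩

theorem exists_isLargeSubalgebra_of_extension {A B : MonounaryAlgebra.{u}}
    (h : Extension A.toUnarySystem B.toUnarySystem) :
    ∃ C, Isomorphic A C ∧ IsLargeSubalgebra C B := by
  obtain ⟨j, hinj, hj, b, hb⟩ := h
  have hne : (Set.range j).Nonempty := let ⟨a⟩ := A.nonempty_carrier; ⟨j a, a, rfl⟩
  have hS : B.IsClosedSet (Set.range j) := by
    rintro _ ⟨x, rfl⟩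
    exact ⟨A.op x, hj x⟩
  refine ⟨B.restrict (Set.range j) hne hS,
    ⟨Equiv.ofInjective j hinj, fun x => Subtype.ext (hj x)⟩, _, hne, hS, rfl, b, ?_⟩
  refine gen_eq_univ_iff.2 fun y => ?_
  rcases hb y with ⟨x, rfl⟩ | ⟨k, rfl⟩
  · exact ⟨j x, Or.inl ⟨x, rfl⟩, 0, rfl⟩
  · exact ⟨b, Or.inr rfl, k, rfl⟩

theorem HasPath.up {A B C : MonounaryAlgebra.{u}} {l : ℕ} (h : HasPath A B l)
    (e : Extension B.toUnarySystem C.toUnarySystem) : HasPath A C (l + 1) := by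
  obtain ⟨D, hD, hL⟩ := exists_isLargeSubalgebra_of_extension e
  exact (h.red hD).blue (Or.inl hL)

theorem HasPath.down {A B C : MonounaryAlgebra.{u}} {l : ℕ} (h : HasPath A B l)
    (e : Extension C.toUnarySystem B.toUnarySystem) : HasPath A C (l + 1) := by
  obtain ⟨D, hD, hL⟩ := exists_isLargeSubalgebra_of_extension e
  exact (h.blue (Or.inr hL)).red (Iso.symm (X := C.toUnarySystem) (Y := D.toUnarySystem) hD)

theorem HasPath.trans {A B C : MonounaryAlgebra.{u}} {l k : ℕ} (h : HasPath A B l)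
    (h' : HasPath B C k) : HasPath A C (l + k) := by
  induction h' with
  | nil => exact h
  | red _ e ih => exact ih.red e
  | blue _ e ih => exact ih.blue e

theorem HasPath.path {A B : MonounaryAlgebra.{u}} {l : ℕ} (h : HasPath A B l) :
    Path A.toUnarySystem B.toUnarySystem l := by
  induction h with
  | nil => exact .iso (.refl _)
  | red _ e ih => exact ih.trans_iso e
  | blue _ e ih =>
    rcases e with e | e
    · exact ih.up e.extension
    · exact ih.down e.extension

/-- The disjoint union of a unary system and a monounary algebra. -/
def addSystem (W : MonounaryAlgebra.{u}) (X : UnarySystem.{u}) : MonounaryAlgebra.{u} where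
  carrier := X.carrier ⊕ W.carrier
  nonempty_carrier := let ⟨w⟩ := W.nonempty_carrier; ⟨Sum.inr w⟩
  op := Sum.map X.op W.op

theorem isomorphic_addSystem_of_isEmpty (W : MonounaryAlgebra.{u}) {E : UnarySystem.{u}}
    (hE : IsEmpty E.carrier) : Isomorphic W (W.addSystem E) :=
  ⟨(Equiv.emptySum E.carrier W.carrier).symm, fun _ => rfl⟩

theorem addSystem_comm (V W : MonounaryAlgebra.{u}) :
    Isomorphic (V.addSystem W.toUnarySystem) (W.addSystem V.toUnarySystem) :=
  ⟨Equiv.sumComm _ _, by rintro (x | x) <;> rfl⟩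

theorem addSystem_isomorphic (W : MonounaryAlgebra.{u}) {X Y : UnarySystem.{u}} (h : Iso X Y) :
    Isomorphic (W.addSystem X) (W.addSystem Y) := by
  obtain ⟨e, he⟩ := h
  exact ⟨Equiv.sumCongr e (Equiv.refl _), by
    rintro (x | x)
    · exact congrArg Sum.inl (he x)
    · rfl⟩

theorem addSystem_extension (W : MonounaryAlgebra.{u}) {X Y : UnarySystem.{u}}
    (h : Extension X Y) :
    Extension (W.addSystem X).toUnarySystem (W.addSystem Y).toUnarySystem := by
  obtain ⟨j, hinj, hj, b, hb⟩ := h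
  refine ⟨Sum.map j id, hinj.sumMap Function.injective_id, ?_, Sum.inl b, ?_⟩
  · rintro (x | x)
    · exact congrArg Sum.inl (hj x)
    · rfl
  · rintro (y | y)
    · rcases hb y with ⟨x, rfl⟩ | ⟨k, rfl⟩
      · exact Or.inl ⟨Sum.inl x, rfl⟩
      · exact Or.inr ⟨k, (UnarySystem.iterate_map (X := Y) (Y := (W.addSystem Y).toUnarySystem)
          (j := Sum.inl) (fun _ => rfl) k b).symm⟩
    · exact Or.inl ⟨Sum.inr y, rfl⟩

theorem hasPath_addSystem (W : MonounaryAlgebra.{u}) {X Y : UnarySystem.{u}} {l : ℕ}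
    (h : Path X Y l) : HasPath (W.addSystem X) (W.addSystem Y) l := by
  induction h with
  | iso e => exact .red .nil (W.addSystem_isomorphic e)
  | up _ e ih => exact ih.up (W.addSystem_extension e)
  | down _ e ih => exact ih.down (W.addSystem_extension e)

/-- The growth of `B` is run beside `A`, then the decay of `A` beside `B`; every intermediate system
is nonempty and the length is the same. -/
theorem hasPath_of_path_through_empty {A B : MonounaryAlgebra.{u}} {E : UnarySystem.{u}}
    (hE : IsEmpty E.carrier) {a b : ℕ} (ha : Path A.toUnarySystem E a)
    (hb : Path E B.toUnarySystem b) : HasPath A B (a + b) := by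
  have h1 := (HasPath.nil.red (isomorphic_addSystem_of_isEmpty A hE)).trans (A.hasPath_addSystem hb)
  have h2 := (h1.red (addSystem_comm A B)).trans (B.hasPath_addSystem ha)
  have h3 := h2.red (Iso.symm (X := B.toUnarySystem)
    (Y := (B.addSystem E).toUnarySystem) (isomorphic_addSystem_of_isEmpty B hE))
  rwa [Nat.zero_add, Nat.add_comm] at h3

theorem hasPath_of_path {A B : MonounaryAlgebra.{u}} {l : ℕ}
    (h : Path A.toUnarySystem B.toUnarySystem l) : HasPath A B l := by
  -- Either no empty system has occurred so far, or the path is cut at the first one. Later empty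
  -- systems are harmless, as that portion is run beside `A`.
  have key : ∀ {Y : UnarySystem.{u}} {l : ℕ}, Path A.toUnarySystem Y l →
      (∃ B : MonounaryAlgebra.{u}, B.toUnarySystem = Y ∧ HasPath A B l) ∨
      ∃ (E : UnarySystem.{u}) (a b : ℕ), IsEmpty E.carrier ∧ Path A.toUnarySystem E a ∧
        Path E Y b ∧ a + b = l := by
    intro Y l h
    induction h with
    | @iso Y e =>
      refine Or.inl ⟨⟨Y.carrier, ?_, Y.op⟩, rfl, .red .nil e⟩
      exact A.nonempty_carrier.map e.choose
    | @up Y Z l h e ih =>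
      rcases ih with ⟨B, rfl, hB⟩ | ⟨E, a, b, hE, ha, hb, rfl⟩
      · refine Or.inl ⟨⟨Z.carrier, ?_, Z.op⟩, rfl, hB.up e⟩
        exact B.nonempty_carrier.map e.choose
      · exact Or.inr ⟨E, a, b + 1, hE, ha, hb.up e, rfl⟩
    | @down Y Z l h e ih =>
      rcases ih with ⟨B, rfl, hB⟩ | ⟨E, a, b, hE, ha, hb, rfl⟩
      · rcases isEmpty_or_nonempty Z.carrier with hZ | hZ
        · exact Or.inr ⟨Z, l + 1, 0, hZ, h.down e, .iso (.refl _), rfl⟩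
        · exact Or.inl ⟨⟨Z.carrier, hZ, Z.op⟩, rfl, hB.down e⟩
      · exact Or.inr ⟨E, a, b + 1, hE, ha, hb.down e, rfl⟩
  rcases key h with ⟨B', hB', hp⟩ | ⟨E, a, b, hE, ha, hb, rfl⟩
  · obtain rfl : B' = B := by
      cases B; cases B'; cases hB'; rfl
    exact hp
  · exact hasPath_of_path_through_empty hE ha hb

theorem dist_toUnarySystem (A B : MonounaryAlgebra.{u}) :
    UnarySystem.dist A.toUnarySystem B.toUnarySystem = A.dist B :=
  le_antisymm (le_iInf₂ fun _ h => h.path.dist_le)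
    (le_iInf₂ fun l h => iInf₂_le l (hasPath_of_path h))

/-- Adding generators one by one gives a path from the empty system; conversely, a path of length
`l` produces at most `l` generators. -/
theorem dist_empty_toUnarySystem {E : UnarySystem.{u}} (hE : IsEmpty E.carrier)
    (A : MonounaryAlgebra.{u}) : UnarySystem.dist E A.toUnarySystem = A.MGen := by
  refine le_antisymm (le_iInf₂ fun X hX => ?_) (le_iInf₂ fun l h => ?_)
  · rcases X.finite_or_infinite with hf | hf
    · lift X to Finset A.carrier using hf
      rw [Set.encard_coe_eq_coe_finsetCard]
      exact (UnarySystem.Generates.path (X := A.toUnarySystem) hE (gen_eq_univ_iff.1 hX)).dist_le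
    · simp [hf.encard_eq]
  · obtain ⟨t, ht, hc⟩ := h.exists_generates hE
    exact (iInf₂_le t (gen_eq_univ_iff.2 ht)).trans hc

/-! ### Padding with empty components -/

/-- A family of monounary algebras, extended by empty systems to a longer index set. -/
def padded {n : ℕ} (As : Fin n → MonounaryAlgebra.{u}) (m : ℕ) (i : Fin m) : UnarySystem.{u} :=
  if h : (i : ℕ) < n then (As ⟨i, h⟩).toUnarySystem else ⟨PEmpty, id⟩

theorem padded_of_lt {n m : ℕ} (As : Fin n → MonounaryAlgebra.{u}) {i : Fin m}
    (h : (i : ℕ) < n) : padded As m i = (As ⟨i, h⟩).toUnarySystem := dif_pos h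

theorem isEmpty_padded {n m : ℕ} (As : Fin n → MonounaryAlgebra.{u}) {i : Fin m}
    (h : n ≤ (i : ℕ)) : IsEmpty (padded As m i).carrier := by
  rw [padded, dif_neg (not_lt.2 h)]
  exact inferInstanceAs (IsEmpty PEmpty)

theorem disjointUnion_iso_padded {n m : ℕ} [NeZero n] (hnm : n ≤ m)
    (As : Fin n → MonounaryAlgebra.{u}) :
    Iso (disjointUnion As).toUnarySystem (UnarySystem.sigma (padded As m)) := by
  have h : ∀ i : Fin n, Iso (As i).toUnarySystem (padded As m (Fin.castLE hnm i)) := fun i =>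
    .of_eq (padded_of_lt (m := m) As (i := Fin.castLE hnm i) i.2).symm
  choose e he using h
  refine .of_bijective (X := (disjointUnion As).toUnarySystem)
    (Y := UnarySystem.sigma (padded As m)) (j := Sigma.map (Fin.castLE hnm) fun i => e i) ⟨?_, ?_⟩ ?_
  · exact (Fin.castLE_injective hnm).sigma_map fun i => (e i).injective
  · rintro ⟨i, x⟩
    have hi : (i : ℕ) < n := by
      by_contra hi
      exact (isEmpty_padded As (not_lt.1 hi)).elim x
    obtain ⟨i, rfl⟩ : ∃ i', Fin.castLE hnm i' = i := ⟨⟨i, hi⟩, rfl⟩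
    obtain ⟨y, rfl⟩ := (e i).surjective x
    exact ⟨⟨i, y⟩, rfl⟩
  · rintro ⟨i, x⟩
    exact congrArg (Sigma.mk (Fin.castLE hnm i)) (he i x)

theorem sum_dist_padded {n m : ℕ} (hnm : n ≤ m) (As : Fin n → MonounaryAlgebra.{u})
    (Bs : Fin m → MonounaryAlgebra.{u}) :
    ∑ i, UnarySystem.dist (padded As m i) (Bs i).toUnarySystem =
      (∑ i : Fin n, (As i).dist (Bs (Fin.castLE hnm i))) +
        ∑ k ∈ Finset.univ.filter (fun k : Fin m => n ≤ k.val), (Bs k).MGen := by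
  rw [← Finset.sum_filter_not_add_sum_filter Finset.univ (fun k : Fin m => n ≤ k.val)]
  congr 1
  · symm
    refine Finset.sum_bij (fun i _ => Fin.castLE hnm i) (fun i _ => by simp)
      (fun i _ i' _ h => Fin.castLE_injective hnm h) (fun k hk => ?_) fun i _ => ?_
    · exact ⟨⟨k, by simpa using hk⟩, Finset.mem_univ _, rfl⟩
    · rw [padded_of_lt (m := m) As (i := Fin.castLE hnm i) i.2, dist_toUnarySystem]
      rfl
  · refine Finset.sum_congr rfl fun k hk => dist_empty_toUnarySystem (isEmpty_padded As ?_) _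
    simpa using hk

end MonounaryAlgebra

/-! ### The distance formula -/

open MonounaryAlgebra UnarySystem in
theorem dist_eq_dist_sigma_padded {n m : ℕ} [NeZero n] [NeZero m] (hnm : n ≤ m)
    {A B : MonounaryAlgebra.{u}} {As : Fin n → MonounaryAlgebra.{u}}
    {Bs : Fin m → MonounaryAlgebra.{u}} (hA : A.Isomorphic (disjointUnion As))
    (hB : B.Isomorphic (disjointUnion Bs)) (π : Equiv.Perm (Fin m)) :
    A.dist B = UnarySystem.dist (sigma (padded As m)) (sigma fun i => (Bs (π i)).toUnarySystem) := by
  have hA' : Iso A.toUnarySystem (sigma (padded As m)) :=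
    Iso.trans (Y := (disjointUnion As).toUnarySystem) hA (disjointUnion_iso_padded hnm As)
  have hπ : Iso (sigma fun i => (Bs (π i)).toUnarySystem) (disjointUnion Bs).toUnarySystem :=
    ⟨Equiv.sigmaCongrLeft (β := fun i => (Bs i).carrier) π, fun _ => rfl⟩
  have hB' : Iso B.toUnarySystem (sigma fun i => (Bs (π i)).toUnarySystem) :=
    Iso.trans (Y := (disjointUnion Bs).toUnarySystem) hB hπ.symm
  rw [← dist_toUnarySystem]
  refine le_antisymm (le_iInf₂ fun l h => Path.dist_le ?_) (le_iInf₂ fun l h => Path.dist_le ?_)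
  · simpa using ((Path.iso hA').trans h).trans_iso hB'.symm
  · simpa using ((Path.iso hA'.symm).trans h).trans_iso hB'

theorem mainTheorem1 {n m : ℕ} [NeZero n] [NeZero m] (hnm : n ≤ m)
    (A B : MonounaryAlgebra.{u})
    (As : Fin n → MonounaryAlgebra.{u}) (Bs : Fin m → MonounaryAlgebra.{u})
    (hAs : ∀ i, (As i).IsConnected) (hBs : ∀ j, (Bs j).IsConnected)
    (hA : A.Isomorphic (MonounaryAlgebra.disjointUnion As))
    (hB : B.Isomorphic (MonounaryAlgebra.disjointUnion Bs)) :
    IsLeast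
      (Set.range fun π : Equiv.Perm (Fin m) =>
        (∑ i : Fin n, (As i).dist (Bs (π (Fin.castLE hnm i)))) +
          ∑ k ∈ Finset.univ.filter (fun k : Fin m => n ≤ k.val), (Bs (π k)).MGen)
      (A.dist B) := by
  have hsum := fun π : Equiv.Perm (Fin m) =>
    MonounaryAlgebra.sum_dist_padded hnm As fun i => Bs (π i)
  simp only [← hsum]
  have hle : ∀ π : Equiv.Perm (Fin m), A.dist B ≤
      ∑ i, UnarySystem.dist (MonounaryAlgebra.padded As m i) (Bs (π i)).toUnarySystem := fun π =>
    (dist_eq_dist_sigma_padded hnm hA hB π).trans_le (UnarySystem.dist_sigma_le _ _)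
  refine ⟨?_, by rintro _ ⟨π, rfl⟩; exact hle π⟩
  -- At infinite distance, the upper bound makes every permutation's sum infinite, so the identity
  -- attains the minimum.
  by_cases htop : A.dist B = ⊤
  · exact ⟨1, le_antisymm (htop ▸ le_top) (hle 1)⟩
  have hd := dist_eq_dist_sigma_padded hnm hA hB 1
  obtain ⟨l, hl, hl'⟩ := UnarySystem.exists_path_of_dist_ne_top (hd ▸ htop)
  have hF : ∀ i x y, (MonounaryAlgebra.padded As m i).Meet x y := by
    intro i
    by_cases hi : (i : ℕ) < n
    · rw [MonounaryAlgebra.padded_of_lt As hi]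
      exact hAs _
    · exact fun x => (MonounaryAlgebra.isEmpty_padded As (not_lt.1 hi)).elim x
  obtain ⟨π, hπ⟩ := UnarySystem.exists_perm_sum_dist_le
    (G := fun j => (Bs j).toUnarySystem) hF (fun j => hBs j)
    (fun j => (Bs j).nonempty_carrier) hl
  exact ⟨π, le_antisymm (hπ.trans (hl'.trans hd.symm).le) (hle π)⟩
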